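/- Let $k>0$, $c>0$ and $\nu>0$. Let $\Gamma_k(x)=\int_0^\infty t^{x-1}e^{-t^k/k}\,dt$ for $x>0$, and let $${}_kW_{\nu,c}(z)=\sum_{n=0}^\infty\frac{(-c)^n}{n!\,\Gamma_k(nk+\nu+k)}\left(\frac z2\right)^{2n+\nu/k}$$ be the generalized $k$-Bessel function, with the normalizations $${}_kg_{\nu,c}(z)=2^{\nu/k}\,\Gamma_k(\nu+k)\,z^{1-\nu/k}\,{}_kW_{\nu,c}(z),\qquad {}_kh_{\nu,c}(z)=2^{\nu/k}\,\Gamma_k(\nu+k)\,z^{1-\nu/(2k)}\,{}_kW_{\nu,c}(\sqrt z),$$ where all powers and roots are principal. For a function $f$ analytic near $0$ with $f(0)=0$ and $f'(0)=1$, the radius of convexity of $f$ is $$r^c(f)=\sup\left\{r>0 : f \text{ is analytic in } |z|<r \text{ and } \operatorname{Re}\left(1+\frac{zf''(z)}{f'(z)}\right)>0\text{ for all }|z|<r\right\},$$ where the inequality includes the requirement $f'(z)\neq0$. Then: (a) $r^c({}_kg_{\nu,c})$ is the smallest positive root of the equation $(z\,{}_kg_{\nu,c}'(z))'=0$, and $$\frac23\sqrt{\frac{\nu+k}{c}}<r^c({}_kg_{\nu,c})<6\sqrt{\frac{(\nu+k)(\nu+2k)}{c(57\nu+137k)}}.$$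 (b) $r^c({}_kh_{\nu,c})$ is the smallest positive root of the equation $(z\,{}_kh_{\nu,c}'(z))'=0$, and $$\frac{\nu+k}{c}<r^c({}_kh_{\nu,c})<\frac{16(\nu+k)(\nu+2k)}{c(7\nu+23k)}.$$ -/

import Mathlib

open scoped Nat

noncomputable section

namespace KBessel

/-- The `k`-gamma function `Γ_k(x) = ∫_0^∞ t^(x-1) exp(-t^k / k) dt` (for `k > 0` and `x > 0`). -/
def kGamma (k x : ℝ) : ℝ :=
  ∫ t in Set.Ioi (0 : ℝ), t ^ (x - 1) * Real.exp (-(t ^ k) / k)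

/-- The generalized `k`-Bessel function `W` of order `ν` with parameter `c`; complex powers are
principal. -/
def kBesselW (k ν c : ℝ) (z : ℂ) : ℂ :=
  ∑' n : ℕ, (((-c) ^ n / ((n ! : ℝ) * kGamma k (n * k + ν + k)) : ℝ) : ℂ) *
    (z / 2) ^ ((2 * n + ν / k : ℝ) : ℂ)

/-- The normalization `g(z) = 2^(ν/k) Γ_k(ν+k) z^(1-ν/k) W(z)`. -/
def kBesselG (k ν c : ℝ) (z : ℂ) : ℂ :=
  (((2 : ℝ) ^ (ν / k) * kGamma k (ν + k) : ℝ) : ℂ) * z ^ ((1 - ν / k : ℝ) : ℂ) *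
    kBesselW k ν c z

/-- The normalization `h(z) = 2^(ν/k) Γ_k(ν+k) z^(1-ν/(2k)) W(√z)`, with the principal square
root. -/
def kBesselH (k ν c : ℝ) (z : ℂ) : ℂ :=
  (((2 : ℝ) ^ (ν / k) * kGamma k (ν + k) : ℝ) : ℂ) * z ^ ((1 - ν / (2 * k) : ℝ) : ℂ) *
    kBesselW k ν c (z ^ (1 / 2 : ℂ))

/-- The radius of convexity (of order zero): the supremum of all `r > 0` such that `f` is analytic
in the open disk of radius `r` about `0` and `Re (1 + z f''(z) / f'(z)) > 0` there. The condition
`f'(z) ≠ 0` says that the quotient is defined. -/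
def radiusOfConvexity (f : ℂ → ℂ) : ℝ :=
  sSup {r : ℝ | 0 < r ∧ DifferentiableOn ℂ f (Metric.ball 0 r) ∧
    ∀ z ∈ Metric.ball (0 : ℂ) r,
      deriv f z ≠ 0 ∧ 0 < (1 + z * deriv (deriv f) z / deriv f z).re}

/-- The positive roots of the equation `(z f'(z))' = 0`. -/
def positiveRoots (f : ℂ → ℂ) : Set ℝ :=
  {r : ℝ | 0 < r ∧ deriv (fun z : ℂ => z * deriv f z) (r : ℂ) = 0}

end KBessel

end

noncomputable section

namespace KBessel

open Finset Filter Topology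

/-! With a = ν/k + 1, q = c/(4k) and F(w) = ₀F₁(a; -w), both normalizations are f(z) = z F(q z^β),
with β = 2 for g and β = 1 for h (`kBesselG_eq`, `kBesselH_eq`). Put w = q z^β. Applying y ↦ y + β w
y' to F once gives f' = P(w), and twice gives (z f')' = `eulerF₂`. Hence 1 + z f''/f' = `eulerF₂`/P,
and the claim is that the real part of this quotient stays positive exactly up to the first positive
zero ω of `eulerF₂`.

No factorization over zeros is used. The function M = -F'/F solves the Riccati equation w M' + a M =
1 + w M², whose recurrence forces nonnegative Taylor coefficients (`besselLogCoeff_nonneg`). Since P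
= F (1 - β w M), the quotient equals 1 - κ - δ/(1 - κ) with κ = β w M and δ = β² w (M + w M'), both
having nonnegative coefficients. So its real part at w is at least its value at |w|, which is
positive for |w| < ω (`re_one_add_eulerFDeriv_div_pos`).

The Taylor series of M converges that far because positivity of `eulerF₂` on (0, ω) passes to P and
to F, and the partial sums of the series are bounded by -F'/F wherever F > 0
(`sum_besselLogCoeff_mul_le`). At ω the quotient vanishes, so the radius is the root itself. The
numerical bounds come from truncating the alternating series of `eulerF₂` (`eulerF₂_pos`,
`eulerF₂_two_neg`, `eulerF₂_one_neg`). -/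

/-- The value at `w` of the power series with real coefficients `b`. -/
def realSeries (𝕜 : Type*) [RCLike 𝕜] (b : ℕ → ℝ) (w : 𝕜) : 𝕜 :=
  ∑' n, (b n : 𝕜) * w ^ n

/-- The coefficients of the derivative of a power series. -/
def derivCoeff (b : ℕ → ℝ) (n : ℕ) : ℝ := (n + 1) * b (n + 1)

/-- The power series with coefficients `b` converges absolutely at every point of `[0, R)`. -/
def ConvergesBelow (b : ℕ → ℝ) (R : ℝ) : Prop :=
  ∀ r, 0 ≤ r → r < R → Summable fun n => |b n| * r ^ n

/-! ### Power series with real coefficients -/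

section series

variable {𝕜 : Type*} [RCLike 𝕜] {b d : ℕ → ℝ} {R : ℝ}

/-- The left side is one term of the binomial expansion of the right. It absorbs the factor n + 1
from differentiation into a slightly larger radius. -/
lemma succ_mul_pow_mul_le {r ε : ℝ} (hr : 0 ≤ r) (hε : 0 ≤ ε) (n : ℕ) :
    (n + 1) * r ^ n * ε ≤ (r + ε) ^ (n + 1) := by
  induction n with
  | zero => simpa using hr
  | succ n ih =>
    have h1 : r ^ (n + 1) ≤ (r + ε) ^ (n + 1) := pow_le_pow_left₀ hr (by linarith) _
    calc ((n + 1 : ℕ) + 1 : ℝ) * r ^ (n + 1) * ε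
        = r * ((n + 1) * r ^ n * ε) + ε * r ^ (n + 1) := by push_cast; ring
      _ ≤ r * (r + ε) ^ (n + 1) + ε * (r + ε) ^ (n + 1) := by gcongr
      _ = (r + ε) ^ (n + 1 + 1) := by ring

lemma ConvergesBelow.derivCoeff (hb : ConvergesBelow b R) :
    ConvergesBelow (derivCoeff b) R := by
  intro r hr hrR
  obtain ⟨s, hrs, hsR⟩ := exists_between hrR
  have hs := (summable_nat_add_iff 1).2 (hb s (hr.trans hrs.le) hsR)
  refine Summable.of_nonneg_of_le (fun n => by positivity) (fun n => ?_)
    (hs.mul_left (s - r)⁻¹)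
  have h := succ_mul_pow_mul_le hr (sub_nonneg.2 hrs.le) n
  rw [add_sub_cancel] at h
  have hε : 0 < s - r := sub_pos.2 hrs
  rw [KBessel.derivCoeff, abs_mul, abs_of_nonneg (by positivity : (0 : ℝ) ≤ n + 1),
    inv_mul_eq_div, le_div_iff₀ hε]
  nlinarith [mul_le_mul_of_nonneg_left h (abs_nonneg (b (n + 1)))]

lemma ConvergesBelow.summable_norm (hb : ConvergesBelow b R) {w : 𝕜} (hw : ‖w‖ < R) :
    Summable fun n => ‖(b n : 𝕜) * w ^ n‖ := by
  simpa [norm_mul, norm_pow, RCLike.norm_ofReal] using hb ‖w‖ (norm_nonneg _) hw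

lemma ConvergesBelow.hasSum (hb : ConvergesBelow b R) {w : 𝕜} (hw : ‖w‖ < R) :
    HasSum (fun n => (b n : 𝕜) * w ^ n) (realSeries 𝕜 b w) :=
  (hb.summable_norm hw).of_norm.hasSum

lemma realSeries_zero (b : ℕ → ℝ) : realSeries 𝕜 b 0 = (b 0 : 𝕜) := by
  rw [realSeries, tsum_eq_single 0 (fun n hn => by simp [hn])]
  simp

lemma realSeries_ofReal (b : ℕ → ℝ) (r : ℝ) :
    realSeries ℂ b (r : ℂ) = ((realSeries ℝ b r : ℝ) : ℂ) := by
  simp [realSeries, Complex.ofReal_tsum]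

lemma ConvergesBelow.hasDerivAt (hb : ConvergesBelow b R) {w : 𝕜} (hw : ‖w‖ < R) :
    HasDerivAt (realSeries 𝕜 b) (realSeries 𝕜 (KBessel.derivCoeff b) w) w := by
  obtain ⟨s, hws, hsR⟩ := exists_between hw
  have hs0 : 0 < s := (norm_nonneg w).trans_lt hws
  have hsum := hb.derivCoeff s hs0.le hsR
  have hu : Summable fun n : ℕ => |b n| * (n * s ^ (n - 1)) := by
    rw [← summable_nat_add_iff 1]
    refine hsum.congr fun n => ?_
    rw [KBessel.derivCoeff, abs_mul, abs_of_nonneg (by positivity : (0 : ℝ) ≤ n + 1)]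
    push_cast [add_tsub_cancel_right]
    ring
  have hbound : ∀ (n : ℕ) (y : 𝕜), y ∈ Metric.ball (0 : 𝕜) s →
      ‖(b n : 𝕜) * (n * y ^ (n - 1))‖ ≤ |b n| * (n * s ^ (n - 1)) := by
    intro n y hy
    rw [mem_ball_zero_iff] at hy
    rw [norm_mul, norm_mul, norm_pow, RCLike.norm_ofReal, RCLike.norm_natCast]
    gcongr
  have hmem : w ∈ Metric.ball (0 : 𝕜) s := by simpa using hws
  have key := hasDerivAt_tsum_of_isPreconnected (𝕜 := 𝕜) (F := 𝕜)
    (g := fun n y => (b n : 𝕜) * y ^ n)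
    (g' := fun n y => (b n : 𝕜) * (n * y ^ (n - 1))) hu Metric.isOpen_ball
    (Metric.isPreconnected_ball) (fun n y _ => (hasDerivAt_pow n y).const_mul _) hbound
    hmem (hb.summable_norm hw).of_norm hmem
  refine key.congr_deriv ?_
  rw [Summable.tsum_eq_zero_add (Summable.of_norm_bounded hu fun n => hbound n w hmem)]
  simp only [CharP.cast_eq_zero, zero_mul, mul_zero, zero_add, realSeries, KBessel.derivCoeff]
  refine tsum_congr fun n => ?_
  push_cast [add_tsub_cancel_right]
  ring

lemma ConvergesBelow.realSeries_mul (hb : ConvergesBelow b R) (hd : ConvergesBelow d R)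
    {w : 𝕜} (hw : ‖w‖ < R) :
    realSeries 𝕜 b w * realSeries 𝕜 d w =
      realSeries 𝕜 (fun n => ∑ ij ∈ antidiagonal n, b ij.1 * d ij.2) w := by
  have h := tsum_mul_tsum_eq_tsum_sum_antidiagonal_of_summable_norm (R := 𝕜)
    (f := fun n => (b n : 𝕜) * w ^ n) (g := fun n => (d n : 𝕜) * w ^ n)
    (hb.summable_norm hw) (hd.summable_norm hw)
  simp only [realSeries]
  rw [h]
  refine tsum_congr fun n => ?_
  push_cast
  rw [sum_mul]
  refine sum_congr rfl fun ij hij => ?_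
  rw [← mem_antidiagonal.1 hij, pow_add]
  ring

lemma ConvergesBelow.norm_realSeries_le (hb : ConvergesBelow b R) (hb0 : ∀ n, 0 ≤ b n)
    {w : 𝕜} (hw : ‖w‖ < R) : ‖realSeries 𝕜 b w‖ ≤ realSeries ℝ b ‖w‖ := by
  have h := hb.summable_norm hw
  refine (norm_tsum_le_tsum_norm h).trans_eq ?_
  refine tsum_congr fun n => ?_
  simp [norm_mul, abs_of_nonneg (hb0 n)]

/-- The coefficients of the primitive, vanishing at the origin, of a power series. -/
def primCoeff (b : ℕ → ℝ) : ℕ → ℝ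
  | 0 => 0
  | n + 1 => b n / (n + 1)

lemma derivCoeff_primCoeff (b : ℕ → ℝ) : KBessel.derivCoeff (primCoeff b) = b := by
  funext n
  have : (n + 1 : ℝ) ≠ 0 := by positivity
  simp only [KBessel.derivCoeff, primCoeff]
  field_simp

lemma ConvergesBelow.primCoeff (hb : ConvergesBelow b R) : ConvergesBelow (primCoeff b) R := by
  intro r hr hrR
  rw [← summable_nat_add_iff 1]
  refine Summable.of_nonneg_of_le (fun n => by positivity) (fun n => ?_)
    ((hb r hr hrR).mul_left r)
  have h1 : |b n / (n + 1)| ≤ |b n| := by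
    rw [abs_div, abs_of_nonneg (by positivity : (0 : ℝ) ≤ n + 1)]
    exact div_le_self (abs_nonneg _) (by linarith [Nat.cast_nonneg (α := ℝ) n])
  calc |b n / (n + 1)| * r ^ (n + 1) ≤ |b n| * r ^ (n + 1) := by gcongr
    _ = r * (|b n| * r ^ n) := by ring

end series

/-! ### Taylor coefficients of ₀F₁ and of -F'/F -/

section coefficients

/-- The coefficients of the confluent hypergeometric limit function `₀F₁(a; -w)`. -/
def besselCoeff (a : ℝ) (n : ℕ) : ℝ := (-1) ^ n / (n ! * ∏ i ∈ range n, (a + i))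

variable {a : ℝ}

lemma besselCoeff_zero (a : ℝ) : besselCoeff a 0 = 1 := by simp [besselCoeff]

lemma besselCoeff_succ (ha : 0 < a) (n : ℕ) :
    (n + 1) * (a + n) * besselCoeff a (n + 1) = -besselCoeff a n := by
  have h1 : ∏ i ∈ range n, (a + i) ≠ 0 := (prod_pos fun i _ => by positivity).ne'
  have h2 : (a + n) ≠ 0 := by positivity
  have h3 : (n ! : ℝ) ≠ 0 := by positivity
  have h4 : (n + 1 : ℝ) ≠ 0 := by positivity
  rw [besselCoeff, besselCoeff, prod_range_succ, Nat.factorial_succ]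
  push_cast
  field_simp
  ring

lemma convergesBelow_besselCoeff (ha : 1 ≤ a) (R : ℝ) : ConvergesBelow (besselCoeff a) R := by
  intro r hr _
  refine Summable.of_nonneg_of_le (fun n => by positivity) (fun n => ?_)
    (Real.summable_pow_div_factorial r)
  have h1 : (1 : ℝ) ≤ ∏ i ∈ range n, (a + i) :=
    Finset.one_le_prod fun i _ => by linarith [Nat.cast_nonneg (α := ℝ) i]
  rw [besselCoeff, abs_div, abs_pow, abs_neg, abs_one, one_pow,
    abs_of_nonneg (by positivity), div_mul_eq_mul_div, one_mul]
  gcongr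
  exact le_mul_of_one_le_right (by positivity) h1

open PowerSeries in
/-- The formal power series of `-F'/F` for `F = ₀F₁(a; -w)`. -/
def besselLogSeries (a : ℝ) : PowerSeries ℝ :=
  -(derivative ℝ (PowerSeries.mk (besselCoeff a))) * (PowerSeries.mk (besselCoeff a))⁻¹

/-- The Taylor coefficients at the origin of `-F'/F` for `F = ₀F₁(a; -w)`. -/
def besselLogCoeff (a : ℝ) (n : ℕ) : ℝ := PowerSeries.coeff n (besselLogSeries a)

open PowerSeries in
lemma mk_besselCoeff_mul_besselLogSeries (a : ℝ) :
    PowerSeries.mk (besselCoeff a) * besselLogSeries a = -(derivative ℝ (PowerSeries.mk (besselCoeff a))) := by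
  have h : constantCoeff (PowerSeries.mk (besselCoeff a)) ≠ 0 := by
    rw [← coeff_zero_eq_constantCoeff_apply, coeff_mk, besselCoeff_zero]
    exact one_ne_zero
  rw [besselLogSeries, mul_left_comm, PowerSeries.mul_inv_cancel _ h, mul_one]

open PowerSeries in
lemma besselSeries_ode (ha : 0 < a) :
    X * derivative ℝ (derivative ℝ (PowerSeries.mk (besselCoeff a))) +
      C a * derivative ℝ (PowerSeries.mk (besselCoeff a)) + PowerSeries.mk (besselCoeff a) = 0 := by
  ext n
  have h := besselCoeff_succ ha n
  rcases n with _ | n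
  · simp only [map_add, coeff_zero_X_mul, coeff_derivative, coeff_mk, coeff_C_mul, map_zero]
    push_cast at h ⊢
    linear_combination h
  · simp only [map_add, coeff_succ_X_mul, coeff_derivative, coeff_mk, coeff_C_mul, map_zero]
    push_cast at h ⊢
    linear_combination h

open PowerSeries in
-- Substituting F' = -M F and its derivative into the differential equation of F leaves F times the
-- Riccati equation, and F is cancelled in the domain of formal power series.
lemma besselLogSeries_riccati (ha : 0 < a) :
    X * derivative ℝ (besselLogSeries a) + C a * besselLogSeries a =
      1 + X * besselLogSeries a ^ 2 := by
  have h0 : PowerSeries.mk (besselCoeff a) ≠ 0 := fun h => by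
    have := congrArg (coeff 0) h
    simp [besselCoeff_zero] at this
  have h1 := mk_besselCoeff_mul_besselLogSeries a
  have h2 := besselSeries_ode ha
  have h3 := congrArg (derivative ℝ) h1
  rw [Derivation.leibniz, smul_eq_mul, smul_eq_mul, map_neg] at h3
  refine mul_left_cancel₀ h0 ?_
  linear_combination X * h3 - h2 + (C a - X * besselLogSeries a) * h1

open PowerSeries in
lemma coeff_X_mul_besselLogSeries_sq (a : ℝ) (n : ℕ) :
    coeff (n + 1) (X * besselLogSeries a ^ 2) =
      ∑ ij ∈ antidiagonal n, besselLogCoeff a ij.1 * besselLogCoeff a ij.2 := by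
  rw [coeff_succ_X_mul, pow_two, coeff_mul]
  rfl

open PowerSeries in
lemma besselLogCoeff_recurrence (ha : 0 < a) (n : ℕ) :
    (n + 1 + a) * besselLogCoeff a (n + 1) =
      ∑ ij ∈ antidiagonal n, besselLogCoeff a ij.1 * besselLogCoeff a ij.2 := by
  have h := congrArg (coeff (n + 1)) (besselLogSeries_riccati ha)
  rw [map_add, map_add, coeff_X_mul_besselLogSeries_sq, coeff_succ_X_mul, coeff_derivative,
    coeff_C_mul, coeff_one, if_neg n.succ_ne_zero, zero_add] at h
  rw [← h, besselLogCoeff]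
  ring

open PowerSeries in
lemma mul_besselLogCoeff_zero (ha : 0 < a) : a * besselLogCoeff a 0 = 1 := by
  have h := congrArg (coeff 0) (besselLogSeries_riccati ha)
  simpa [besselLogCoeff] using h

lemma besselLogCoeff_nonneg (ha : 0 < a) (n : ℕ) : 0 ≤ besselLogCoeff a n := by
  induction n using Nat.strong_induction_on with
  | _ n ih =>
    rcases n with _ | n
    · have := mul_besselLogCoeff_zero ha
      by_contra! h
      nlinarith
    · have h := besselLogCoeff_recurrence ha n
      have h2 : 0 ≤ (n + 1 + a) * besselLogCoeff a (n + 1) := by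
        rw [h]
        refine sum_nonneg fun ij hij => ?_
        have := HasAntidiagonal.mem_antidiagonal.1 hij
        exact mul_nonneg (ih _ (by lia)) (ih _ (by lia))
      exact nonneg_of_mul_nonneg_right h2 (by positivity)

lemma sum_besselCoeff_mul_besselLogCoeff (a : ℝ) (n : ℕ) :
    ∑ ij ∈ antidiagonal n, besselCoeff a ij.1 * besselLogCoeff a ij.2 =
      -derivCoeff (besselCoeff a) n := by
  have h := congrArg (PowerSeries.coeff n) (mk_besselCoeff_mul_besselLogSeries a)
  rw [PowerSeries.coeff_mul, map_neg, PowerSeries.coeff_derivative] at h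
  simp only [PowerSeries.coeff_mk] at h
  rw [derivCoeff, mul_comm (_ + 1 : ℝ), ← h]
  rfl

/-- The pairs with i + j < N form a subset of the square of pairs i, j < N, and the omitted products
are nonnegative. -/
lemma sum_range_antidiagonal_le {m : ℕ → ℝ} (hm : ∀ n, 0 ≤ m n) {r : ℝ} (hr : 0 ≤ r) (N : ℕ) :
    ∑ n ∈ range N, (∑ ij ∈ antidiagonal n, m ij.1 * m ij.2) * r ^ n ≤
      (∑ n ∈ range N, m n * r ^ n) ^ 2 := by
  rw [pow_two, sum_mul_sum, ← sum_product']
  refine le_trans (le_of_eq ?_) (sum_fiberwise_le_sum_of_sum_fiber_nonneg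
    (t := range N) (g := fun ij : ℕ × ℕ => ij.1 + ij.2)
    (fun y _ => sum_nonneg fun ij _ => by have := hm ij.1; have := hm ij.2; positivity))
  refine sum_congr rfl fun n hn => ?_
  have : (range N ×ˢ range N).filter (fun ij : ℕ × ℕ => ij.1 + ij.2 = n) = antidiagonal n := by
    ext ij
    simp only [mem_filter, mem_product, mem_range, HasAntidiagonal.mem_antidiagonal] at hn ⊢
    lia
  rw [this, sum_mul]
  refine sum_congr rfl fun ij hij => ?_
  rw [← HasAntidiagonal.mem_antidiagonal.1 hij, pow_add]
  ring

/-- The partial sums of the series of `-F'/F` are subsolutions of its Riccati equation. -/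
lemma sum_besselLogCoeff_riccati_le (ha : 0 < a) {r : ℝ} (hr : 0 ≤ r) (N : ℕ) :
    ∑ n ∈ range (N + 1), (n + a) * besselLogCoeff a n * r ^ n ≤
      1 + r * (∑ n ∈ range (N + 1), besselLogCoeff a n * r ^ n) ^ 2 := by
  have hm := besselLogCoeff_nonneg ha
  rw [sum_range_succ' (fun n : ℕ => (n + a) * besselLogCoeff a n * r ^ n)]
  have h1 := sum_range_antidiagonal_le hm hr N
  have h2 : ∑ n ∈ range N, besselLogCoeff a n * r ^ n ≤
      ∑ n ∈ range (N + 1), besselLogCoeff a n * r ^ n := by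
    rw [sum_range_succ]
    have := hm N
    exact le_add_of_nonneg_right (by positivity)
  have h3 : 0 ≤ ∑ n ∈ range N, besselLogCoeff a n * r ^ n :=
    sum_nonneg fun n _ => by have := hm n; positivity
  have h4 : ∑ n ∈ range N, ((n + 1 : ℕ) + a) * besselLogCoeff a (n + 1) * r ^ (n + 1) =
      r * ∑ n ∈ range N, (∑ ij ∈ antidiagonal n,
        besselLogCoeff a ij.1 * besselLogCoeff a ij.2) * r ^ n := by
    rw [mul_sum]
    refine sum_congr rfl fun n _ => ?_
    rw [← besselLogCoeff_recurrence ha n]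
    push_cast
    ring
  have h5 := mul_besselLogCoeff_zero ha
  rw [h4]
  simp only [CharP.cast_eq_zero, zero_add, pow_zero, mul_one, h5]
  have h6 := mul_le_mul_of_nonneg_left (h1.trans (pow_le_pow_left₀ h3 h2 2)) hr
  linarith

end coefficients

/-! ### Positivity through the Euler operator -/

section comparison

variable {α R : ℝ} {y y' : ℝ → ℝ}

lemma hasDerivAt_rpow_mul (hy : ∀ r, HasDerivAt y (y' r) r) {r : ℝ} (hr : 0 < r) :
    HasDerivAt (fun r => r ^ α * y r) (r ^ (α - 1) * (α * y r + r * y' r)) r := by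
  refine ((Real.hasDerivAt_rpow_const (p := α) (Or.inl hr.ne')).mul (hy r)).congr_deriv ?_
  have h : r ^ α = r ^ (α - 1) * r := by
    rw [← Real.rpow_add_one hr.ne', sub_add_cancel]
  rw [h]
  ring

lemma continuous_rpow_mul (hα : 0 < α) (hy : ∀ r, HasDerivAt y (y' r) r) :
    Continuous fun r => r ^ α * y r :=
  (Real.continuous_rpow_const hα.le).mul
    (continuous_iff_continuousAt.2 fun r => (hy r).continuousAt)

/-- Multiplication by the integrating factor r^α turns α y + r y' into a derivative up to the factor
r^(α-1). Since α > 0, the product r^α y starts from 0 at the origin, so no initial condition on y is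
needed. -/
lemma nonneg_of_euler_nonneg (hα : 0 < α) (hy : ∀ r, HasDerivAt y (y' r) r)
    (h : ∀ r, 0 < r → r < R → 0 ≤ α * y r + r * y' r) {r : ℝ} (hr : 0 < r) (hrR : r < R) :
    0 ≤ y r := by
  have hmono : MonotoneOn (fun r => r ^ α * y r) (Set.Icc 0 r) := by
    refine monotoneOn_of_deriv_nonneg (convex_Icc _ _) (continuous_rpow_mul hα hy).continuousOn
      (fun x hx => ?_) (fun x hx => ?_) <;> rw [interior_Icc] at hx
    · exact (hasDerivAt_rpow_mul hy hx.1).differentiableAt.differentiableWithinAt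
    · rw [(hasDerivAt_rpow_mul hy hx.1).deriv]
      exact mul_nonneg (Real.rpow_nonneg hx.1.le _) (h x hx.1 (hx.2.trans hrR))
  have h1 := hmono (Set.left_mem_Icc.2 hr.le) (Set.right_mem_Icc.2 hr.le) hr.le
  simp only [Real.zero_rpow hα.ne', zero_mul] at h1
  exact nonneg_of_mul_nonneg_right h1 (Real.rpow_pos_of_pos hr _)

lemma pos_of_euler_pos (hα : 0 < α) (hy : ∀ r, HasDerivAt y (y' r) r)
    (h : ∀ r, 0 < r → r < R → 0 < α * y r + r * y' r) {r : ℝ} (hr : 0 < r) (hrR : r < R) :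
    0 < y r := by
  have hmono : StrictMonoOn (fun r => r ^ α * y r) (Set.Icc 0 r) := by
    refine strictMonoOn_of_deriv_pos (convex_Icc _ _) (continuous_rpow_mul hα hy).continuousOn
      (fun x hx => ?_)
    rw [interior_Icc] at hx
    rw [(hasDerivAt_rpow_mul hy hx.1).deriv]
    exact mul_pos (Real.rpow_pos_of_pos hx.1 _) (h x hx.1 (hx.2.trans hrR))
  have h1 := hmono (Set.left_mem_Icc.2 hr.le) (Set.right_mem_Icc.2 hr.le) hr
  simp only [Real.zero_rpow hα.ne', zero_mul] at h1
  exact pos_of_mul_pos_right h1 (Real.rpow_nonneg hr.le _)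

end comparison

/-! ### The function ₀F₁ and its Euler transforms -/

section hypergeometric

variable (𝕜 : Type*) [RCLike 𝕜]

/-- The function `₀F₁(a; -w)`. -/
def besselF (a : ℝ) : 𝕜 → 𝕜 := realSeries 𝕜 (besselCoeff a)

/-- The derivative of `₀F₁(a; -w)`. -/
def besselFDeriv (a : ℝ) : 𝕜 → 𝕜 := realSeries 𝕜 (derivCoeff (besselCoeff a))

/-- The second derivative of `₀F₁(a; -w)`. -/
def besselFDeriv₂ (a : ℝ) : 𝕜 → 𝕜 := realSeries 𝕜 (derivCoeff (derivCoeff (besselCoeff a)))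

/-- The function `F + β w F'` for `F(w) = ₀F₁(a; -w)`. -/
def eulerF (a : ℝ) (β : ℕ) (w : 𝕜) : 𝕜 := besselF 𝕜 a w + β * w * besselFDeriv 𝕜 a w

/-- The derivative of `F + β w F'` for `F(w) = ₀F₁(a; -w)`. -/
def eulerFDeriv (a : ℝ) (β : ℕ) (w : 𝕜) : 𝕜 :=
  (1 + β) * besselFDeriv 𝕜 a w + β * w * besselFDeriv₂ 𝕜 a w

/-- The function obtained from `₀F₁(a; -w)` by applying the operator `y ↦ y + β w y'` twice. -/
def eulerF₂ (a : ℝ) (β : ℕ) (w : 𝕜) : 𝕜 := eulerF 𝕜 a β w + β * w * eulerFDeriv 𝕜 a β w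

variable {𝕜} {a R : ℝ} {β : ℕ}

lemma hasDerivAt_besselF (ha : 1 ≤ a) (w : 𝕜) :
    HasDerivAt (besselF 𝕜 a) (besselFDeriv 𝕜 a w) w :=
  (convergesBelow_besselCoeff ha (‖w‖ + 1)).hasDerivAt (lt_add_one _)

lemma hasDerivAt_besselFDeriv (ha : 1 ≤ a) (w : 𝕜) :
    HasDerivAt (besselFDeriv 𝕜 a) (besselFDeriv₂ 𝕜 a w) w :=
  (convergesBelow_besselCoeff ha (‖w‖ + 1)).derivCoeff.hasDerivAt (lt_add_one _)

lemma hasDerivAt_eulerF (ha : 1 ≤ a) (w : 𝕜) :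
    HasDerivAt (eulerF 𝕜 a β) (eulerFDeriv 𝕜 a β w) w := by
  have h := (hasDerivAt_besselF ha w).add
    (((hasDerivAt_id w).const_mul (β : 𝕜)).mul (hasDerivAt_besselFDeriv ha w))
  refine h.congr_deriv ?_
  simp only [eulerFDeriv, id_eq, mul_one]
  ring

lemma besselF_zero (a : ℝ) : besselF 𝕜 a 0 = 1 := by
  simp [besselF, realSeries_zero, besselCoeff_zero]

lemma eulerF_ofReal (a : ℝ) (β : ℕ) (r : ℝ) :
    eulerF ℂ a β (r : ℂ) = ((eulerF ℝ a β r : ℝ) : ℂ) := by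
  simp [eulerF, besselF, besselFDeriv, realSeries_ofReal]

lemma eulerFDeriv_ofReal (a : ℝ) (β : ℕ) (r : ℝ) :
    eulerFDeriv ℂ a β (r : ℂ) = ((eulerFDeriv ℝ a β r : ℝ) : ℂ) := by
  simp [eulerFDeriv, besselFDeriv₂, besselFDeriv, realSeries_ofReal]

lemma eulerF₂_ofReal (a : ℝ) (β : ℕ) (r : ℝ) :
    eulerF₂ ℂ a β (r : ℂ) = ((eulerF₂ ℝ a β r : ℝ) : ℂ) := by
  simp [eulerF₂, eulerF_ofReal, eulerFDeriv_ofReal]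

lemma ConvergesBelow.hasSum_mul_deriv {b : ℕ → ℝ} (hb : ConvergesBelow b R) {w : 𝕜}
    (hw : ‖w‖ < R) :
    HasSum (fun n : ℕ => (n : 𝕜) * b n * w ^ n) (w * realSeries 𝕜 (KBessel.derivCoeff b) w) := by
  refine (hasSum_nat_add_iff' 1).1 ?_
  simp only [range_one, sum_singleton, CharP.cast_eq_zero, zero_mul, sub_zero]
  have h : (fun n : ℕ => ((n + 1 : ℕ) : 𝕜) * b (n + 1) * w ^ (n + 1)) =
      fun n => w * ((KBessel.derivCoeff b n : 𝕜) * w ^ n) := by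
    funext n
    simp only [KBessel.derivCoeff]
    push_cast
    ring
  rw [h]
  exact (hb.derivCoeff.hasSum hw).mul_left w

lemma besselF_ode (ha : 1 ≤ a) (w : 𝕜) :
    w * besselFDeriv₂ 𝕜 a w + a * besselFDeriv 𝕜 a w + besselF 𝕜 a w = 0 := by
  have hb := convergesBelow_besselCoeff ha (‖w‖ + 1)
  have hw := lt_add_one ‖w‖
  have h := ((hb.derivCoeff.hasSum_mul_deriv hw).add
    ((hb.derivCoeff.hasSum hw).mul_left (a : 𝕜))).add (hb.hasSum hw)
  refine h.unique ?_
  convert hasSum_zero with n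
  have h1 := congrArg (fun x : ℝ => (x : 𝕜)) (besselCoeff_succ (zero_lt_one.trans_le ha) n)
  simp only [derivCoeff]
  push_cast at h1 ⊢
  linear_combination w ^ n * h1

/-- The power series expansion of `eulerF₂`. -/
lemma hasSum_eulerF₂ (ha : 1 ≤ a) (β : ℕ) (w : 𝕜) :
    HasSum (fun n : ℕ => (β * n + 1 : 𝕜) ^ 2 * besselCoeff a n * w ^ n) (eulerF₂ 𝕜 a β w) := by
  have hb := convergesBelow_besselCoeff ha (‖w‖ + 1)
  have hw := lt_add_one ‖w‖
  have h0 := hb.hasSum hw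
  have h1 := hb.hasSum_mul_deriv hw
  have h2 : HasSum (fun n : ℕ => (n : 𝕜) * (n - 1) * besselCoeff a n * w ^ n)
      (w * (w * besselFDeriv₂ 𝕜 a w)) := by
    refine (hasSum_nat_add_iff' 1).1 ?_
    simp only [range_one, sum_singleton, CharP.cast_eq_zero, zero_mul, sub_zero]
    have h : (fun n : ℕ => ((n + 1 : ℕ) : 𝕜) * ((n + 1 : ℕ) - 1) * besselCoeff a (n + 1) *
        w ^ (n + 1)) = fun n : ℕ => w * ((n : 𝕜) * (derivCoeff (besselCoeff a) n : ℝ) * w ^ n) := by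
      funext n
      simp only [derivCoeff]
      push_cast
      ring
    rw [h]
    exact (hb.derivCoeff.hasSum_mul_deriv hw).mul_left w
  have h := (h0.add (h1.mul_left ((β : 𝕜) * (2 + β)))).add (h2.mul_left ((β : 𝕜) ^ 2))
  have e1 : eulerF₂ 𝕜 a β w = besselF 𝕜 a w + β * (2 + β) * (w * besselFDeriv 𝕜 a w) +
      β ^ 2 * (w * (w * besselFDeriv₂ 𝕜 a w)) := by
    simp only [eulerF₂, eulerF, eulerFDeriv]
    ring
  have e2 : (fun n : ℕ => (β * n + 1 : 𝕜) ^ 2 * besselCoeff a n * w ^ n) = fun n : ℕ =>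
      (besselCoeff a n : 𝕜) * w ^ n + β * (2 + β) * (n * besselCoeff a n * w ^ n) +
        β ^ 2 * (n * (n - 1) * besselCoeff a n * w ^ n) := by
    funext n
    ring
  rw [e1, e2]
  exact h

end hypergeometric

/-! ### Convergence of the series of -F'/F where F is positive -/

section comparison

variable {a R : ℝ}

/-- Partial sums of the Taylor series of `-F'/F` stay below `-F'/F` as long as `F` is positive. -/
lemma sum_besselLogCoeff_mul_le (ha : 1 ≤ a) (hF : ∀ r, 0 < r → r < R → 0 < besselF ℝ a r)
    (N : ℕ) {r : ℝ} (hr : 0 < r) (hrR : r < R) :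
    (∑ n ∈ range (N + 1), besselLogCoeff a n * r ^ n) * besselF ℝ a r ≤
      -besselFDeriv ℝ a r := by
  have ha0 : 0 < a := zero_lt_one.trans_le ha
  set m := besselLogCoeff a
  let S : ℝ → ℝ := fun r => ∑ n ∈ range (N + 1), m n * r ^ n
  let S' : ℝ → ℝ := fun r => ∑ n ∈ range (N + 1), m n * (n * r ^ (n - 1))
  let T : ℝ → ℝ := fun r => ∑ n ∈ range (N + 1), m n / (n + 1) * r ^ (n + 1)
  have hS : ∀ r, HasDerivAt S (S' r) r := fun r =>
    HasDerivAt.fun_sum fun n _ => (hasDerivAt_pow n r).const_mul _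
  have hT : ∀ r, HasDerivAt T (S r) r := fun r => by
    refine (HasDerivAt.fun_sum fun n _ =>
      (hasDerivAt_pow (n + 1) r).const_mul (m n / (n + 1))).congr_deriv ?_
    refine sum_congr rfl fun n _ => ?_
    have : (n + 1 : ℝ) ≠ 0 := by positivity
    push_cast [add_tsub_cancel_right]
    field_simp
  have hSa : ∀ r, 0 ≤ r → r * S' r + a * S r ≤ 1 + r * S r ^ 2 := fun r hr => by
    refine le_trans (le_of_eq ?_) (sum_besselLogCoeff_riccati_le ha0 hr N)
    simp only [S, S']
    rw [mul_sum, mul_sum, ← sum_add_distrib]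
    refine sum_congr rfl fun n _ => ?_
    rcases n with _ | n
    · simp [m]
    · push_cast [add_tsub_cancel_right]
      ring
  -- As T' = S, the factor exp(-T) cancels the terms S F' in a y + r y'. By the differential
  -- equation of F, what remains is exp(-T) F times the Riccati defect of S, which is nonnegative.
  let y : ℝ → ℝ := fun r => Real.exp (-T r) * (-besselFDeriv ℝ a r - S r * besselF ℝ a r)
  have hy : ∀ r, HasDerivAt y (Real.exp (-T r) * (-S r) *
      (-besselFDeriv ℝ a r - S r * besselF ℝ a r) + Real.exp (-T r) *
      (-besselFDeriv₂ ℝ a r - (S' r * besselF ℝ a r + S r * besselFDeriv ℝ a r))) r := fun r =>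
    (hT r).neg.exp.mul ((hasDerivAt_besselFDeriv ha r).neg.sub
      ((hS r).mul (hasDerivAt_besselF ha r)))
  have key : 0 ≤ y r := by
    refine nonneg_of_euler_nonneg ha0 hy (fun x hx hxR => ?_) hr hrR
    have h1 := besselF_ode ha x
    have h2 : 0 ≤ Real.exp (-T x) * (besselF ℝ a x *
        (1 + x * S x ^ 2 - (x * S' x + a * S x))) :=
      mul_nonneg (Real.exp_nonneg _) (mul_nonneg (hF x hx hxR).le (sub_nonneg.2 (hSa x hx.le)))
    simp only [RCLike.ofReal_real_eq_id, id_eq] at h1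
    refine h2.trans_eq ?_
    simp only [y]
    linear_combination Real.exp (-T x) * h1
  exact sub_nonneg.1 (nonneg_of_mul_nonneg_right key (Real.exp_pos _))

/-- The terms are nonnegative, and at any s < R the partial sums are bounded by -F'(s)/F(s). -/
lemma convergesBelow_besselLogCoeff (ha : 1 ≤ a)
    (hF : ∀ r, 0 < r → r < R → 0 < besselF ℝ a r) : ConvergesBelow (besselLogCoeff a) R := by
  intro r hr hrR
  have hm := besselLogCoeff_nonneg (zero_lt_one.trans_le ha)
  obtain ⟨s, hrs, hsR⟩ := exists_between hrR
  have hs : 0 < s := hr.trans_lt hrs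
  have hsum : Summable fun n => besselLogCoeff a n * s ^ n := by
    refine summable_of_sum_range_le (c := -besselFDeriv ℝ a s / besselF ℝ a s)
      (fun n => mul_nonneg (hm n) (by positivity)) fun N => ?_
    refine (sum_le_sum_of_subset_of_nonneg (range_mono N.le_succ)
      fun n _ _ => mul_nonneg (hm n) (by positivity)).trans ?_
    exact (le_div_iff₀ (hF s hs hsR)).2 (sum_besselLogCoeff_mul_le ha hF N hs hsR)
  refine Summable.of_nonneg_of_le (fun n => by positivity) (fun n => ?_) hsum
  rw [abs_of_nonneg (hm n)]
  exact mul_le_mul_of_nonneg_left (pow_le_pow_left₀ hr hrs.le n) (hm n)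

end comparison

/-! ### The logarithmic derivative in the complex disk -/

section logDerivative

variable (𝕜 : Type*) [RCLike 𝕜]

/-- The sum of the Taylor series of `-F'/F` for `F(w) = ₀F₁(a; -w)`. -/
def besselLog (a : ℝ) : 𝕜 → 𝕜 := realSeries 𝕜 (besselLogCoeff a)

/-- The derivative of the Taylor series of `-F'/F` for `F(w) = ₀F₁(a; -w)`. -/
def besselLogDeriv (a : ℝ) : 𝕜 → 𝕜 := realSeries 𝕜 (derivCoeff (besselLogCoeff a))

variable {𝕜} {a R : ℝ} {w : 𝕜}

lemma besselFDeriv_eq (ha : 1 ≤ a) (hR : ConvergesBelow (besselLogCoeff a) R) (hw : ‖w‖ < R) :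
    besselFDeriv 𝕜 a w = -(besselLog 𝕜 a w * besselF 𝕜 a w) := by
  have h := (convergesBelow_besselCoeff ha R).realSeries_mul hR hw
  simp only [sum_besselCoeff_mul_besselLogCoeff] at h
  rw [besselLog, besselF, mul_comm, h]
  simp [besselFDeriv, realSeries, tsum_neg]

lemma besselFDeriv₂_eq (ha : 1 ≤ a) (hR : ConvergesBelow (besselLogCoeff a) R) (hw : ‖w‖ < R) :
    besselFDeriv₂ 𝕜 a w =
      (besselLog 𝕜 a w ^ 2 - besselLogDeriv 𝕜 a w) * besselF 𝕜 a w := by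
  have h1 : HasDerivAt (fun w => -(besselLog 𝕜 a w * besselF 𝕜 a w))
      (-(besselLogDeriv 𝕜 a w * besselF 𝕜 a w + besselLog 𝕜 a w * besselFDeriv 𝕜 a w)) w :=
    ((hR.hasDerivAt hw).mul (hasDerivAt_besselF ha w)).neg
  have h2 : (fun w => -(besselLog 𝕜 a w * besselF 𝕜 a w)) =ᶠ[𝓝 w] besselFDeriv 𝕜 a := by
    have : {w : 𝕜 | ‖w‖ < R} ∈ 𝓝 w := (isOpen_lt continuous_norm continuous_const).mem_nhds hw
    filter_upwards [this] with v hv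
    exact (besselFDeriv_eq ha hR hv).symm
  rw [(hasDerivAt_besselFDeriv ha w).unique (h1.congr_of_eventuallyEq h2.symm),
    besselFDeriv_eq ha hR hw]
  ring

/-- If T is the primitive of M vanishing at 0, then F exp(T) has derivative zero on the disk, so a
zero of F would contradict its value at the origin. -/
lemma besselF_ne_zero {w : ℂ} (ha : 1 ≤ a) (hR : ConvergesBelow (besselLogCoeff a) R)
    (hw : ‖w‖ < R) : besselF ℂ a w ≠ 0 := by
  let T : ℂ → ℂ := realSeries ℂ (primCoeff (besselLogCoeff a))
  have hd : ∀ v ∈ Metric.ball (0 : ℂ) R,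
      HasDerivAt (fun v => besselF ℂ a v * Complex.exp (T v)) 0 v := by
    intro v hv
    rw [mem_ball_zero_iff] at hv
    have hT : HasDerivAt T (besselLog ℂ a v) v := by
      have := hR.primCoeff.hasDerivAt hv
      rwa [derivCoeff_primCoeff] at this
    refine ((hasDerivAt_besselF ha v).mul hT.cexp).congr_deriv ?_
    rw [besselFDeriv_eq ha hR hv]
    ring
  have hR0 : 0 < R := (norm_nonneg w).trans_lt hw
  have h := Metric.isOpen_ball.is_const_of_deriv_eq_zero (Metric.isPreconnected_ball)
    (fun v hv => (hd v hv).differentiableAt.differentiableWithinAt)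
    (fun v hv => (hd v hv).deriv) (mem_ball_zero_iff.2 hw) (Metric.mem_ball_self hR0)
  intro h0
  simp only [h0, besselF_zero, zero_mul, one_mul] at h
  exact Complex.exp_ne_zero _ h.symm

variable {β : ℕ}

lemma eulerF_eq (ha : 1 ≤ a) (hR : ConvergesBelow (besselLogCoeff a) R) (hw : ‖w‖ < R) :
    eulerF 𝕜 a β w = besselF 𝕜 a w * (1 - β * w * besselLog 𝕜 a w) := by
  rw [eulerF, besselFDeriv_eq ha hR hw]
  ring

lemma mul_eulerFDeriv_eq (ha : 1 ≤ a) (hR : ConvergesBelow (besselLogCoeff a) R)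
    (hw : ‖w‖ < R) :
    β * w * eulerFDeriv 𝕜 a β w = -(β * w * besselLog 𝕜 a w * eulerF 𝕜 a β w) -
      besselF 𝕜 a w * (β ^ 2 * w * (besselLog 𝕜 a w + w * besselLogDeriv 𝕜 a w)) := by
  rw [eulerF_eq ha hR hw, eulerFDeriv, besselFDeriv_eq ha hR hw, besselFDeriv₂_eq ha hR hw]
  ring

/-- This form involves only M and M', whose coefficients are nonnegative, so it can be compared with
its value at |w|. -/
lemma one_add_eulerFDeriv_div (ha : 1 ≤ a) (hR : ConvergesBelow (besselLogCoeff a) R)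
    (hw : ‖w‖ < R) (hF : besselF 𝕜 a w ≠ 0) (h1 : 1 - β * w * besselLog 𝕜 a w ≠ 0) :
    1 + β * w * eulerFDeriv 𝕜 a β w / eulerF 𝕜 a β w = 1 - β * w * besselLog 𝕜 a w -
      β ^ 2 * w * (besselLog 𝕜 a w + w * besselLogDeriv 𝕜 a w) /
        (1 - β * w * besselLog 𝕜 a w) := by
  rw [mul_eulerFDeriv_eq ha hR hw, eulerF_eq ha hR hw]
  field_simp
  ring

end logDerivative

/-! ### Positivity of the real part -/

section convexity

variable {a R : ℝ} {β : ℕ}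

/-- Dividing y + β r y' by β gives the Euler operator with exponent α = 1/β. -/
lemma eulerF_pos (ha : 1 ≤ a) (hβ : 0 < β) (h : ∀ r, 0 < r → r < R → 0 < eulerF₂ ℝ a β r)
    {r : ℝ} (hr : 0 < r) (hrR : r < R) : 0 < eulerF ℝ a β r := by
  have hβ' : (0 : ℝ) < β := by exact_mod_cast hβ
  refine pos_of_euler_pos (inv_pos.2 hβ') (hasDerivAt_eulerF ha) (fun x hx hxR => ?_) hr hrR
  have := mul_pos (inv_pos.2 hβ') (h x hx hxR)
  rw [eulerF₂, mul_add, mul_assoc (β : ℝ), inv_mul_cancel_left₀ hβ'.ne'] at this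
  exact this

lemma besselF_pos (ha : 1 ≤ a) (hβ : 0 < β) (h : ∀ r, 0 < r → r < R → 0 < eulerF ℝ a β r)
    {r : ℝ} (hr : 0 < r) (hrR : r < R) : 0 < besselF ℝ a r := by
  have hβ' : (0 : ℝ) < β := by exact_mod_cast hβ
  refine pos_of_euler_pos (inv_pos.2 hβ') (hasDerivAt_besselF ha) (fun x hx hxR => ?_) hr hrR
  have := mul_pos (inv_pos.2 hβ') (h x hx hxR)
  rw [eulerF, mul_add, mul_assoc (β : ℝ), inv_mul_cancel_left₀ hβ'.ne'] at this
  exact this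

lemma re_one_sub_sub_div_ge {κ δ : ℂ} {k d : ℝ} (hκ : ‖κ‖ ≤ k) (hk : k < 1) (hδ : ‖δ‖ ≤ d) :
    1 - κ ≠ 0 ∧ 1 - k - d / (1 - k) ≤ (1 - κ - δ / (1 - κ)).re := by
  have h1 : 1 - k ≤ ‖1 - κ‖ := by
    have := norm_sub_norm_le (1 : ℂ) κ
    rw [norm_one] at this
    linarith
  have h2 : ‖δ / (1 - κ)‖ ≤ d / (1 - k) := by
    rw [norm_div]
    exact div_le_div₀ ((norm_nonneg _).trans hδ) hδ (sub_pos.2 hk) h1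
  refine ⟨norm_pos_iff.1 ((sub_pos.2 hk).trans_le h1), ?_⟩
  have h3 := (Complex.re_le_norm κ).trans hκ
  have h4 := (Complex.re_le_norm _).trans h2
  simp only [Complex.sub_re, Complex.one_re]
  linarith

/-- As long as `eulerF₂` is positive on `(0, R)`, the function `w ↦ 1 + β w P'(w) / P(w)` with
`P = F + β w F'` has positive real part in the disk of radius `R`. -/
theorem re_one_add_eulerFDeriv_div_pos (ha : 1 ≤ a) (hβ : 0 < β)
    (h : ∀ r, 0 < r → r < R → 0 < eulerF₂ ℝ a β r) {w : ℂ} (hw : ‖w‖ < R) :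
    eulerF ℂ a β w ≠ 0 ∧ 0 < (1 + β * w * eulerFDeriv ℂ a β w / eulerF ℂ a β w).re := by
  have hP : ∀ r, 0 < r → r < R → 0 < eulerF ℝ a β r := fun r => eulerF_pos ha hβ h
  have hF : ∀ r, 0 < r → r < R → 0 < besselF ℝ a r := fun r => besselF_pos ha hβ hP
  have hR := convergesBelow_besselLogCoeff ha hF
  have hm := besselLogCoeff_nonneg (zero_lt_one.trans_le ha)
  rcases eq_or_ne w 0 with rfl | hw0
  · simp [eulerF, besselF_zero]
  have hr := norm_pos_iff.2 hw0
  set r := ‖w‖ with hr_def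
  have hrR : ‖r‖ < R := by rwa [Real.norm_of_nonneg hr.le]
  have hM : ‖besselLog ℂ a w‖ ≤ besselLog ℝ a r := hR.norm_realSeries_le hm hw
  have hM' : ‖besselLogDeriv ℂ a w‖ ≤ besselLogDeriv ℝ a r :=
    hR.derivCoeff.norm_realSeries_le (fun n => mul_nonneg (by positivity) (hm _)) hw
  have hFr := hF r hr hw
  have hPr := hP r hr hw
  have h1 : 0 < 1 - β * r * besselLog ℝ a r := by
    rw [eulerF_eq ha hR hrR] at hPr
    exact pos_of_mul_pos_right hPr hFr.le
  -- The same identity at the real point r = |w| identifies the lower bound for the real part with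
  -- `eulerF₂`/P at r, which is positive by hypothesis.
  have hreal := one_add_eulerFDeriv_div (β := β) ha hR hrR hFr.ne' h1.ne'
  have hpos : 0 < 1 + β * r * eulerFDeriv ℝ a β r / eulerF ℝ a β r := by
    have := div_pos (h r hr hw) hPr
    rwa [eulerF₂, add_div, div_self hPr.ne'] at this
  have hκ : ‖β * w * besselLog ℂ a w‖ ≤ β * r * besselLog ℝ a r := by
    rw [norm_mul, norm_mul, Complex.norm_natCast]
    gcongr
  have hδ : ‖β ^ 2 * w * (besselLog ℂ a w + w * besselLogDeriv ℂ a w)‖ ≤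
      β ^ 2 * r * (besselLog ℝ a r + r * besselLogDeriv ℝ a r) := by
    rw [norm_mul, norm_mul, norm_pow, Complex.norm_natCast]
    have := norm_add_le (besselLog ℂ a w) (w * besselLogDeriv ℂ a w)
    rw [norm_mul] at this
    gcongr
    exact this.trans (by gcongr)
  obtain ⟨hne, hge⟩ := re_one_sub_sub_div_ge hκ (sub_pos.1 h1) hδ
  have hFw := besselF_ne_zero ha hR hw
  refine ⟨by rw [eulerF_eq ha hR hw]; exact mul_ne_zero hFw hne, ?_⟩
  rw [one_add_eulerFDeriv_div ha hR hw hFw hne]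
  rw [hreal] at hpos
  exact hpos.trans_le hge

end convexity

/-! ### The radius of convexity as a first root -/

section radius

variable {a q : ℝ} {β : ℕ}

/-- The function `z ↦ z F(q z^β)` with `F(w) = ₀F₁(a; -w)`. -/
def besselNormalized (a q : ℝ) (β : ℕ) (z : ℂ) : ℂ := z * besselF ℂ a (q * z ^ β)

lemma mul_hasDerivAt_comp_pow (hβ : 0 < β) {f : ℂ → ℂ} {f' z : ℂ}
    (hf : HasDerivAt f f' (q * z ^ β)) :
    ∃ d, HasDerivAt (fun z : ℂ => f (q * z ^ β)) d z ∧ z * d = β * (q * z ^ β) * f' := by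
  refine ⟨_, HasDerivAt.comp z hf ((hasDerivAt_pow β z).const_mul (q : ℂ)), ?_⟩
  rw [← mul_pow_sub_one hβ.ne' z]
  ring

lemma hasDerivAt_besselNormalized (ha : 1 ≤ a) (hβ : 0 < β) (z : ℂ) :
    HasDerivAt (besselNormalized a q β) (eulerF ℂ a β (q * z ^ β)) z := by
  obtain ⟨d, hd, hzd⟩ := mul_hasDerivAt_comp_pow (q := q) (z := z) hβ (hasDerivAt_besselF ha _)
  refine ((hasDerivAt_id z).mul hd).congr_deriv ?_
  simp only [id_eq, one_mul, hzd, eulerF]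

lemma deriv_besselNormalized (ha : 1 ≤ a) (hβ : 0 < β) :
    deriv (besselNormalized a q β) = fun z => eulerF ℂ a β (q * z ^ β) :=
  funext fun z => (hasDerivAt_besselNormalized ha hβ z).deriv

lemma mul_deriv_deriv_besselNormalized (ha : 1 ≤ a) (hβ : 0 < β) (z : ℂ) :
    z * deriv (deriv (besselNormalized a q β)) z =
      β * (q * z ^ β) * eulerFDeriv ℂ a β (q * z ^ β) := by
  rw [deriv_besselNormalized ha hβ]
  obtain ⟨d, hd, hzd⟩ := mul_hasDerivAt_comp_pow (q := q) (z := z) hβ (hasDerivAt_eulerF ha _)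
  rw [hd.deriv, hzd]

lemma deriv_mul_deriv_besselNormalized (ha : 1 ≤ a) (hβ : 0 < β) (z : ℂ) :
    deriv (fun z => z * deriv (besselNormalized a q β) z) z = eulerF₂ ℂ a β (q * z ^ β) := by
  rw [deriv_besselNormalized ha hβ]
  obtain ⟨d, hd, hzd⟩ := mul_hasDerivAt_comp_pow (q := q) (z := z) hβ (hasDerivAt_eulerF ha _)
  refine (((hasDerivAt_id z).mul hd).congr_deriv ?_).deriv
  simp only [id_eq, one_mul, hzd, eulerF₂]

lemma positiveRoots_besselNormalized (ha : 1 ≤ a) (hβ : 0 < β) :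
    positiveRoots (besselNormalized a q β) = {r | 0 < r ∧ eulerF₂ ℝ a β (q * r ^ β) = 0} := by
  ext r
  simp only [positiveRoots, Set.mem_ofPred_eq, deriv_mul_deriv_besselNormalized ha hβ]
  rw [← Complex.ofReal_pow, ← Complex.ofReal_mul, eulerF₂_ofReal, Complex.ofReal_eq_zero]

lemma continuous_eulerF₂ (ha : 1 ≤ a) : Continuous (eulerF₂ ℝ a β) := by
  have h0 : Continuous (eulerF ℝ a β) :=
    continuous_iff_continuousAt.2 fun r => (hasDerivAt_eulerF ha r).continuousAt
  have h1 : Continuous (besselFDeriv ℝ a) :=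
    continuous_iff_continuousAt.2 fun r => (hasDerivAt_besselFDeriv ha r).continuousAt
  have h2 : Continuous (besselFDeriv₂ ℝ a) := continuous_iff_continuousAt.2 fun r =>
    ((convergesBelow_besselCoeff ha (‖r‖ + 1)).derivCoeff.derivCoeff.hasDerivAt
      (lt_add_one _)).continuousAt
  unfold eulerF₂ eulerFDeriv
  fun_prop

lemma eulerF₂_zero (a : ℝ) (β : ℕ) : eulerF₂ ℝ a β 0 = 1 := by
  simp [eulerF₂, eulerF, besselF_zero]

lemma exists_root_of_eulerF₂_nonpos (ha : 1 ≤ a) {w : ℝ} (hw : 0 < w)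
    (h : eulerF₂ ℝ a β w ≤ 0) : ∃ x, 0 < x ∧ x ≤ w ∧ eulerF₂ ℝ a β x = 0 := by
  obtain ⟨x, hx, hx0⟩ := intermediate_value_Icc' hw.le (continuous_eulerF₂ ha).continuousOn
    (show (0 : ℝ) ∈ Set.Icc (eulerF₂ ℝ a β w) (eulerF₂ ℝ a β 0) by
      rw [eulerF₂_zero]; exact ⟨h, zero_le_one⟩)
  refine ⟨x, hx.1.lt_of_ne ?_, hx.2, hx0⟩
  rintro rfl
  rw [eulerF₂_zero] at hx0
  exact one_ne_zero hx0

/-- The first positive zero of `eulerF₂` below a point at which this function is negative. -/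
lemma exists_first_root_eulerF₂ (ha : 1 ≤ a) {u : ℝ} (hu : 0 < u) (h : eulerF₂ ℝ a β u < 0) :
    ∃ ω, 0 < ω ∧ ω < u ∧ eulerF₂ ℝ a β ω = 0 ∧ ∀ w, 0 < w → w < ω → 0 < eulerF₂ ℝ a β w := by
  have hcomp : IsCompact (Set.Icc 0 u ∩ {w | eulerF₂ ℝ a β w = 0}) :=
    isCompact_Icc.inter_right (isClosed_eq (continuous_eulerF₂ ha) continuous_const)
  obtain ⟨x, hx, hxu, hx0⟩ := exists_root_of_eulerF₂_nonpos ha hu h.le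
  obtain ⟨ω, ⟨hωu, hω0⟩, hmin⟩ := hcomp.exists_isLeast ⟨x, ⟨hx.le, hxu⟩, hx0⟩
  have hω0' : eulerF₂ ℝ a β ω = 0 := hω0
  refine ⟨ω, hωu.1.lt_of_ne ?_, hωu.2.lt_of_ne ?_, hω0, fun w hw hwω => ?_⟩
  · rintro rfl
    rw [eulerF₂_zero] at hω0'
    exact one_ne_zero hω0'
  · rintro rfl
    exact h.ne hω0
  · by_contra! hneg
    obtain ⟨y, hy, hyw, hy0⟩ := exists_root_of_eulerF₂_nonpos ha hw hneg
    exact absurd (hmin ⟨⟨hy.le, (hyw.trans hwω.le).trans hωu.2⟩, hy0⟩) (hyw.trans_lt hwω).not_ge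

/-- The radius of convexity of `z ↦ z F(q z^β)` is the least positive root of `(z f'(z))' = 0`;
it is located by the sign of `eulerF₂`. -/
theorem radiusOfConvexity_besselNormalized (ha : 1 ≤ a) (hβ : 0 < β) (hq : 0 < q) {l u : ℝ}
    (hl : 0 < l) (hu : 0 < u) (hpos : ∀ w, 0 < w → w ≤ q * l ^ β → 0 < eulerF₂ ℝ a β w)
    (hneg : eulerF₂ ℝ a β (q * u ^ β) < 0) :
    IsLeast (positiveRoots (besselNormalized a q β))
        (radiusOfConvexity (besselNormalized a q β)) ∧
      l < radiusOfConvexity (besselNormalized a q β) ∧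
      radiusOfConvexity (besselNormalized a q β) < u := by
  obtain ⟨ω, hω, hωu, hω0, hmin⟩ := exists_first_root_eulerF₂ ha (by positivity) hneg
  obtain ⟨ρ, hρ, hρω⟩ : ∃ ρ : ℝ, 0 < ρ ∧ q * ρ ^ β = ω :=
    ⟨(ω / q) ^ (β : ℝ)⁻¹, by positivity, by
      rw [Real.rpow_inv_natCast_pow (by positivity) hβ.ne', mul_div_cancel₀ _ hq.ne']⟩
  have hlt : ∀ {r s : ℝ}, 0 ≤ r → 0 ≤ s → (q * r ^ β < q * s ^ β ↔ r < s) := fun hr hs => by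
    rw [mul_lt_mul_iff_right₀ hq, pow_lt_pow_iff_left₀ hr hs hβ.ne']
  -- The supremum is attained, because the condition concerns the open disk of radius ρ. A larger
  -- disk contains ρ itself, where the quotient is `eulerF₂`/P = 0.
  have hrad : radiusOfConvexity (besselNormalized a q β) = ρ := by
    refine IsGreatest.csSup_eq ⟨⟨hρ, fun z _ => (hasDerivAt_besselNormalized ha hβ
      z).differentiableAt.differentiableWithinAt, fun z hz => ?_⟩, fun r hr => ?_⟩
    · have hz' : ‖(q : ℂ) * z ^ β‖ < ω := by
        rw [norm_mul, norm_pow, Complex.norm_of_nonneg hq.le, ← hρω,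
          hlt (norm_nonneg z) hρ.le]
        simpa using hz
      rw [mul_deriv_deriv_besselNormalized ha hβ, deriv_besselNormalized ha hβ]
      exact re_one_add_eulerFDeriv_div_pos ha hβ hmin hz'
    · by_contra! hρr
      have hmem : (ρ : ℂ) ∈ Metric.ball (0 : ℂ) r := by
        simpa [abs_of_pos hρ] using hρr
      obtain ⟨h1, h2⟩ := hr.2.2 _ hmem
      rw [mul_deriv_deriv_besselNormalized ha hβ] at h2
      rw [deriv_besselNormalized ha hβ] at h1 h2
      have hcast : (q : ℂ) * (ρ : ℂ) ^ β = (ω : ℝ) := by rw [← hρω]; push_cast; rfl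
      simp only [hcast] at h1 h2
      have h3 : eulerF₂ ℂ a β (ω : ℂ) = 0 := by rw [eulerF₂_ofReal, hω0, Complex.ofReal_zero]
      rw [← div_self h1, ← add_div, ← eulerF₂, h3, zero_div, Complex.zero_re] at h2
      exact h2.false
  rw [hrad, positiveRoots_besselNormalized ha hβ]
  refine ⟨⟨⟨hρ, by rw [hρω, hω0]⟩, fun r hr => ?_⟩, ?_, ?_⟩
  · by_contra! hrρ
    have h1 := (hlt hr.1.le hρ.le).2 hrρ
    have h2 := hr.1
    exact (hmin _ (by positivity) (hρω ▸ h1)).ne' hr.2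
  · rw [← hlt hl.le hρ.le, hρω]
    by_contra! h
    exact (hpos ω hω h).ne' hω0
  · rwa [← hlt hρ.le hu.le, hρω]

end radius

/-! ### Alternating series bounds for the first root -/

section bounds

variable {a w : ℝ} {β : ℕ}

/-- The absolute values of the terms of the power series of `eulerF₂`. -/
def eulerTerm (a : ℝ) (β : ℕ) (w : ℝ) (n : ℕ) : ℝ :=
  (β * n + 1) ^ 2 * w ^ n / (n ! * ∏ i ∈ range n, (a + i))

lemma hasSum_eulerTerm (ha : 1 ≤ a) (β : ℕ) (w : ℝ) :
    HasSum (fun n => (-1) ^ n * eulerTerm a β w n) (eulerF₂ ℝ a β w) := by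
  have h := hasSum_eulerF₂ ha β w
  have e : (fun n => (-1) ^ n * eulerTerm a β w n) = fun n : ℕ =>
      ((β : ℝ) * n + 1) ^ 2 * ((besselCoeff a n : ℝ) : ℝ) * w ^ n := by
    funext n
    rw [eulerTerm, besselCoeff]
    ring
  rw [e]
  exact h

/-- The ratio of consecutive terms is ((β(n+1)+1)/(βn+1))² w/((n+1)(a+n)). For n ≥ 1 and β ≤ 2 the
fraction inside the square is at most 5/3, and the denominator (n+1)(a+n) is at least 2(a+1). -/
lemma eulerTerm_succ_lt (ha : 1 ≤ a) (hβ : β ≤ 2) (hw : 0 < w) (h : 25 * w < 18 * (a + 1))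
    {n : ℕ} (hn : 1 ≤ n) : eulerTerm a β w (n + 1) < eulerTerm a β w n := by
  have h1 : 0 < ∏ i ∈ range n, (a + i) := prod_pos fun i _ => by positivity
  have hn' : (1 : ℝ) ≤ n := by exact_mod_cast hn
  have hβ' : (β : ℝ) ≤ 2 := by exact_mod_cast hβ
  have hβ0 : (0 : ℝ) ≤ β := β.cast_nonneg
  have h2 : (3 * (β * (n + 1 : ℕ) + 1) : ℝ) ≤ 5 * (β * n + 1) := by
    push_cast
    nlinarith
  have h3 := pow_le_pow_left₀ (by positivity) h2 2
  have h4 : 2 * (a + 1) ≤ (n + 1) * (a + n) := by nlinarith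
  have key : (β * (n + 1 : ℕ) + 1 : ℝ) ^ 2 * w < (β * n + 1) ^ 2 * ((n + 1) * (a + n)) := by
    have h5 : (β * (n + 1 : ℕ) + 1 : ℝ) ^ 2 * w * 9 ≤ (β * n + 1) ^ 2 * (25 * w) := by
      nlinarith [mul_le_mul_of_nonneg_right h3 hw.le]
    have h6 : (β * n + 1 : ℝ) ^ 2 * (25 * w) < (β * n + 1) ^ 2 * (9 * ((n + 1) * (a + n))) :=
      mul_lt_mul_of_pos_left (by linarith) (by positivity)
    linarith
  rw [eulerTerm, eulerTerm, prod_range_succ, Nat.factorial_succ, div_lt_div_iff₀ (by positivity)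
    (by positivity)]
  have h7 := mul_lt_mul_of_pos_left key
    (show 0 < w ^ n * (n ! * ∏ i ∈ range n, (a + i)) by positivity)
  push_cast at h7 ⊢
  calc _ = w ^ n * (n ! * ∏ i ∈ range n, (a + i)) * ((β * (n + 1) + 1) ^ 2 * w) := by ring
    _ < _ := h7
    _ = _ := by ring

lemma eulerF₂_pos (ha : 1 ≤ a) (hβ0 : 1 ≤ β) (hβ : β ≤ 2) (hw : 0 < w)
    (h : (β + 1) ^ 2 * w ≤ a) : 0 < eulerF₂ ℝ a β w := by
  have hβ' : (1 : ℝ) ≤ β := by exact_mod_cast hβ0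
  have h25 : 25 * w < 18 * (a + 1) := by
    nlinarith [mul_le_mul_of_nonneg_right (pow_le_pow_left₀ zero_le_two
      (show (2 : ℝ) ≤ β + 1 by linarith) 2) hw.le]
  have h01 : eulerTerm a β w 1 ≤ eulerTerm a β w 0 := by
    simpa [eulerTerm] using div_le_one_of_le₀ h (by linarith)
  have hanti : Antitone (eulerTerm a β w) := antitone_nat_of_succ_le fun n => by
    rcases n with _ | n
    · exact h01
    · exact (eulerTerm_succ_lt ha hβ hw h25 (by lia)).le
  -- Four terms are kept because the first two may cancel when (β+1)² w = a. Strictness comes from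
  -- the pair of indices 2 and 3.
  have h4 := hanti.alternating_series_le_tendsto (hasSum_eulerTerm ha β w).tendsto_sum_nat 2
  have h23 := eulerTerm_succ_lt ha hβ hw h25 (n := 2) (by lia)
  simp only [sum_range_succ, range_zero, sum_empty] at h4
  norm_num at h4 h23
  linarith

/-- The constant term is split off because the terms are only known to decrease from index 1 on: at
the points where this is used, term 1 exceeds term 0. -/
lemma eulerF₂_le (ha : 1 ≤ a) (hβ : β ≤ 2) (hw : 0 < w) (h25 : 25 * w < 18 * (a + 1)) (m : ℕ) :
    eulerF₂ ℝ a β w ≤ 1 - ∑ i ∈ range (2 * m), (-1) ^ i * eulerTerm a β w (i + 1) := by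
  have hanti : Antitone fun n => eulerTerm a β w (n + 1) := antitone_nat_of_succ_le fun n =>
    (eulerTerm_succ_lt ha hβ hw h25 (by lia)).le
  have hs := ((hasSum_nat_add_iff' 1).2 (hasSum_eulerTerm ha β w)).neg
  have e : (fun n => -((-1) ^ (n + 1) * eulerTerm a β w (n + 1))) =
      fun n => (-1) ^ n * eulerTerm a β w (n + 1) := by
    funext n
    ring
  rw [e] at hs
  have := hanti.alternating_series_le_tendsto hs.tendsto_sum_nat m
  simp [eulerTerm] at this ⊢
  linarith

/-- Here the quadratic truncation 1 - 9w/a + 25w²/(2a(a+1)) is already negative. The point lies at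
or slightly below the Euler–Rayleigh quotient 9a(a+1)/(56a+81) formed from these coefficients. -/
lemma eulerF₂_two_neg (ha : 1 ≤ a) :
    eulerF₂ ℝ a 2 (9 * a * (a + 1) / (57 * a + 80)) < 0 := by
  have ha0 : 0 < a := by linarith
  have hD : 0 < 57 * a + 80 := by positivity
  refine (eulerF₂_le ha le_rfl (by positivity) ?_ 1).trans_lt ?_
  · rw [mul_div_assoc', div_lt_iff₀ hD]
    nlinarith
  · have e : 1 - ∑ i ∈ range (2 * 1), (-1) ^ i *
        eulerTerm a 2 (9 * a * (a + 1) / (57 * a + 80)) (i + 1) =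
        -(711 * a ^ 2 + 1929 * a + 160) / (2 * (57 * a + 80) ^ 2) := by
      simp only [eulerTerm, sum_range_succ, prod_range_succ, Nat.factorial, mul_one, range_zero,
        sum_empty, prod_empty]
      push_cast
      field_simp
      ring
    rw [e]
    exact div_neg_of_neg_of_pos (by nlinarith) (by positivity)

/-- The point is the Euler–Rayleigh quotient of 1 - 4w/a + 9w²/(2a(a+1)). That quadratic takes there
the value 9a(a-8)/(7a+16)², which is not negative for a ≥ 8, so the truncation goes to degree four.
-/
lemma eulerF₂_one_neg (ha : 1 ≤ a) :
    eulerF₂ ℝ a 1 (4 * a * (a + 1) / (7 * a + 16)) < 0 := by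
  have ha0 : 0 < a := by linarith
  have hD : 0 < 7 * a + 16 := by positivity
  refine (eulerF₂_le ha one_le_two (by positivity) ?_ 2).trans_lt ?_
  · rw [mul_div_assoc', div_lt_iff₀ hD]
    nlinarith
  · have e : 1 - ∑ i ∈ range (2 * 2), (-1) ^ i *
        eulerTerm a 1 (4 * a * (a + 1) / (7 * a + 16)) (i + 1) =
        -(a * (110592 + 183296 * a + 119056 * a ^ 2 + 39954 * a ^ 3 + 7211 * a ^ 4 +
          487 * a ^ 5)) / ((a + 2) * (a + 3) * (7 * a + 16) ^ 4) := by
      simp only [eulerTerm, sum_range_succ, prod_range_succ, Nat.factorial, mul_one, range_zero,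
        sum_empty, prod_empty]
      push_cast
      field_simp
      ring
    rw [e]
    exact div_neg_of_neg_of_pos (neg_neg_of_pos (by positivity)) (by positivity)

end bounds

/-! ### Reduction of the k-Bessel functions to ₀F₁ -/

section normalization

variable {k ν c : ℝ}

lemma kGamma_eq (hk : 0 < k) {x : ℝ} (hx : 0 < x) :
    kGamma k x = (1 / k) ^ (-x / k) * (1 / k) * Real.Gamma (x / k) := by
  have h := integral_rpow_mul_exp_neg_mul_rpow hk (q := x - 1) (by linarith) (one_div_pos.2 hk)
  rw [sub_add_cancel] at h
  rw [← h, kGamma]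
  refine MeasureTheory.integral_congr_ae (Eventually.of_forall fun t => ?_)
  beta_reduce
  rw [neg_div, div_eq_mul_one_div, mul_comm (t ^ k), neg_mul]

lemma kGamma_pos (hk : 0 < k) {x : ℝ} (hx : 0 < x) : 0 < kGamma k x := by
  rw [kGamma_eq hk hx]
  have := Real.Gamma_pos_of_pos (div_pos hx hk)
  positivity

lemma kGamma_add (hk : 0 < k) {x : ℝ} (hx : 0 < x) : kGamma k (x + k) = x * kGamma k x := by
  have h1 : (x + k) / k = x / k + 1 := by field_simp
  have h2 : -(x + k) / k = -x / k - 1 := by field_simp; ring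
  rw [kGamma_eq hk hx, kGamma_eq hk (by linarith), h1, h2,
    Real.Gamma_add_one (div_pos hx hk).ne', Real.rpow_sub_one (by positivity)]
  field_simp

lemma kGamma_nat_mul_add (hk : 0 < k) (hν : 0 < ν) (n : ℕ) :
    kGamma k (n * k + ν + k) =
      kGamma k (ν + k) * (k ^ n * ∏ i ∈ range n, (ν / k + 1 + i)) := by
  induction n with
  | zero => simp
  | succ n ih =>
    have h : ((n + 1 : ℕ) : ℝ) * k + ν + k = (n * k + ν + k) + k := by push_cast; ring
    rw [h, kGamma_add hk (by positivity), ih, prod_range_succ]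
    field_simp
    ring

lemma div_two_cpow {z : ℂ} (hz : z ≠ 0) (s : ℝ) :
    (z / 2) ^ (s : ℂ) = z ^ (s : ℂ) * (((2 : ℝ) ^ (-s) : ℝ) : ℂ) := by
  have h1 : z / 2 = ((2⁻¹ : ℝ) : ℂ) * z := by push_cast; ring
  have h2 : z / 2 ≠ 0 := div_ne_zero hz two_ne_zero
  rw [Complex.cpow_def_of_ne_zero h2, Complex.cpow_def_of_ne_zero hz, h1,
    Complex.log_ofReal_mul (by norm_num) hz, Real.rpow_def_of_pos two_pos, Complex.ofReal_exp,
    ← Complex.exp_add, Real.log_inv]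
  congr 1
  push_cast
  ring

/-- Halving the argument keeps it in (-π, π], so the principal branches are compatible for every z.
-/
lemma sqrt_cpow {z : ℂ} (s : ℝ) : (z ^ (1 / 2 : ℂ)) ^ (s : ℂ) = z ^ ((s / 2 : ℝ) : ℂ) := by
  have him : (Complex.log z * (1 / 2)).im = Complex.arg z / 2 := by
    rw [show (1 / 2 : ℂ) = ((1 / 2 : ℝ) : ℂ) by push_cast; rfl, Complex.im_mul_ofReal,
      Complex.log_im]
    ring
  have h1 := Complex.neg_pi_lt_arg z
  have h2 := Complex.arg_le_pi z
  have h3 := Real.pi_pos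
  rw [← Complex.cpow_mul _ (by rw [him]; linarith) (by rw [him]; linarith)]
  congr 1
  push_cast
  ring

/-- This makes the normalizations vanish at the origin whatever value the prefactor power takes
there, so the identities with `besselNormalized` hold at 0 as well. -/
lemma kBesselW_zero (hk : 0 < k) (hν : 0 < ν) : kBesselW k ν c 0 = 0 := by
  refine (tsum_congr fun n => ?_).trans tsum_zero
  have h : (2 * n + ν / k : ℝ) ≠ 0 := by positivity
  rw [zero_div, Complex.zero_cpow (Complex.ofReal_ne_zero.2 h), mul_zero]

/-- The coefficients of the normalized series in terms of those of `₀F₁`. -/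
lemma normalization_mul_coeff (hk : 0 < k) (hν : 0 < ν) (n : ℕ) :
    (2 : ℝ) ^ (ν / k) * kGamma k (ν + k) *
        ((-c) ^ n / (n ! * kGamma k (n * k + ν + k)) * (2 : ℝ) ^ (-(2 * n + ν / k))) =
      besselCoeff (ν / k + 1) n * (c / (4 * k)) ^ n := by
  have h1 : (2 : ℝ) ^ (-(2 * n + ν / k)) = ((2 : ℝ) ^ (ν / k))⁻¹ * (4 ^ n)⁻¹ := by
    rw [neg_add_rev, Real.rpow_add two_pos, Real.rpow_neg two_pos.le, Real.rpow_neg two_pos.le,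
      Real.rpow_mul two_pos.le, Real.rpow_natCast]
    norm_num
  have h2 := (kGamma_pos hk (x := ν + k) (by positivity)).ne'
  have h3 : (∏ i ∈ range n, (ν / k + 1 + i)) ≠ 0 := (prod_pos fun i _ => by positivity).ne'
  have h4 : (2 : ℝ) ^ (ν / k) ≠ 0 := by positivity
  rw [h1, kGamma_nat_mul_add hk hν, besselCoeff, neg_pow, div_pow, mul_pow]
  field_simp

lemma besselF_complex (a : ℝ) (w : ℂ) :
    besselF ℂ a w = ∑' n, (besselCoeff a n : ℂ) * w ^ n := rfl

lemma kBesselG_eq (hk : 0 < k) (hν : 0 < ν) :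
    kBesselG k ν c = besselNormalized (ν / k + 1) (c / (4 * k)) 2 := by
  funext z
  rcases eq_or_ne z 0 with rfl | hz
  · simp [kBesselG, kBesselW_zero hk hν, besselNormalized]
  rw [kBesselG, kBesselW, besselNormalized, besselF_complex, ← tsum_mul_left, ← tsum_mul_left]
  refine tsum_congr fun n => ?_
  -- The fractional exponents cancel, leaving an integer power, so the branch cut disappears.
  have hpow : z ^ ((1 - ν / k : ℝ) : ℂ) * z ^ ((2 * n + ν / k : ℝ) : ℂ) = z * (z ^ 2) ^ n := by
    rw [← Complex.cpow_add _ _ hz, ← pow_mul, ← pow_succ', ← Complex.cpow_natCast]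
    congr 1
    push_cast
    ring
  have hcoeff := congrArg (fun x : ℝ => (x : ℂ)) (normalization_mul_coeff (c := c) hk hν n)
  simp only [Complex.ofReal_mul, Complex.ofReal_pow] at hcoeff
  rw [div_two_cpow hz, mul_pow, Complex.ofReal_mul]
  linear_combination z * (z ^ 2) ^ n * hcoeff + Complex.ofReal ((2 : ℝ) ^ (ν / k)) *
    Complex.ofReal (kGamma k (ν + k)) *
    Complex.ofReal ((-c) ^ n / (n ! * kGamma k (n * k + ν + k))) *
    Complex.ofReal ((2 : ℝ) ^ (-(2 * n + ν / k))) * hpow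

lemma kBesselH_eq (hk : 0 < k) (hν : 0 < ν) :
    kBesselH k ν c = besselNormalized (ν / k + 1) (c / (4 * k)) 1 := by
  funext z
  rcases eq_or_ne z 0 with rfl | hz
  · simp [kBesselH, kBesselW_zero hk hν, besselNormalized]
  rw [kBesselH, kBesselW, besselNormalized, besselF_complex, ← tsum_mul_left, ← tsum_mul_left]
  refine tsum_congr fun n => ?_
  have hsqrt : z ^ (1 / 2 : ℂ) ≠ 0 := by simp [Complex.cpow_eq_zero_iff, hz]
  have hpow : z ^ ((1 - ν / (2 * k) : ℝ) : ℂ) * z ^ (((2 * n + ν / k) / 2 : ℝ) : ℂ) =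
      z * z ^ n := by
    rw [← Complex.cpow_add _ _ hz, ← pow_succ', ← Complex.cpow_natCast]
    congr 1
    push_cast
    field_simp
    ring
  have hcoeff := congrArg (fun x : ℝ => (x : ℂ)) (normalization_mul_coeff (c := c) hk hν n)
  simp only [Complex.ofReal_mul, Complex.ofReal_pow] at hcoeff
  rw [div_two_cpow hsqrt, sqrt_cpow, pow_one, mul_pow, Complex.ofReal_mul]
  linear_combination z * z ^ n * hcoeff + Complex.ofReal ((2 : ℝ) ^ (ν / k)) *
    Complex.ofReal (kGamma k (ν + k)) *
    Complex.ofReal ((-c) ^ n / (n ! * kGamma k (n * k + ν + k))) *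
    Complex.ofReal ((2 : ℝ) ^ (-(2 * n + ν / k))) * hpow

end normalization

end KBessel

end

theorem theorem4 (k c ν : ℝ) (hk : 0 < k) (hc : 0 < c) (hν : 0 < ν) :
    (IsLeast (KBessel.positiveRoots (KBessel.kBesselG k ν c))
        (KBessel.radiusOfConvexity (KBessel.kBesselG k ν c)) ∧
      2 / 3 * Real.sqrt ((ν + k) / c) < KBessel.radiusOfConvexity (KBessel.kBesselG k ν c) ∧
      KBessel.radiusOfConvexity (KBessel.kBesselG k ν c) <
        6 * Real.sqrt ((ν + k) * (ν + 2 * k) / (c * (57 * ν + 137 * k)))) ∧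
    (IsLeast (KBessel.positiveRoots (KBessel.kBesselH k ν c))
        (KBessel.radiusOfConvexity (KBessel.kBesselH k ν c)) ∧
      (ν + k) / c < KBessel.radiusOfConvexity (KBessel.kBesselH k ν c) ∧
      KBessel.radiusOfConvexity (KBessel.kBesselH k ν c) <
        16 * (ν + k) * (ν + 2 * k) / (c * (7 * ν + 23 * k))) := by
  have ha : 1 ≤ ν / k + 1 := by
    have : 0 < ν / k := by positivity
    linarith
  rw [KBessel.kBesselG_eq hk hν, KBessel.kBesselH_eq hk hν]
  refine ⟨KBessel.radiusOfConvexity_besselNormalized ha two_pos (by positivity) (by positivity)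
      (by positivity) (fun w hw hwl => KBessel.eulerF₂_pos ha one_le_two le_rfl hw ?_) ?_,
    KBessel.radiusOfConvexity_besselNormalized ha one_pos (by positivity) (by positivity)
      (by positivity) (fun w hw hwl => KBessel.eulerF₂_pos ha le_rfl one_le_two hw ?_) ?_⟩
  · rw [mul_pow, Real.sq_sqrt (by positivity)] at hwl
    -- The lower bounds are exactly the points where (β+1)² w = a, that is w = a/9 for g and w = a/4
    -- for h.
    have e : c / (4 * k) * ((2 / 3) ^ 2 * ((ν + k) / c)) = (ν / k + 1) / 9 := by
      field_simp
      ring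
    rw [e] at hwl
    norm_num
    linarith
  · rw [mul_pow, Real.sq_sqrt (by positivity)]
    refine lt_of_eq_of_lt (congrArg _ ?_) (KBessel.eulerF₂_two_neg ha)
    field_simp
    ring
  · have e : c / (4 * k) * ((ν + k) / c) ^ 1 = (ν / k + 1) / 4 := by
      field_simp
    rw [e] at hwl
    norm_num
    linarith
  · refine lt_of_eq_of_lt (congrArg _ ?_) (KBessel.eulerF₂_one_neg ha)
    field_simp
    ring
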